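/- Let $\mathcal{D}$ be a set of datasets, let $\simeq$ be an arbitrary (not necessarily symmetric) neighbouring relation on $\mathcal{D}$ for which at least one neighbouring pair $D\simeq D'$ exists, and let $\mathcal{M}$ be a mechanism, i.e. a map assigning to every $D\in\mathcal{D}$ a probability distribution $\mathcal{M}(D)$ on a measurable space $\mathcal{O}$. For $\alpha\ge 0$ and probability distributions $P,Q$ on the same measurable space, let $$H_\alpha(P\|Q)=\mathbb{E}_{o\sim Q}\Big[\Big(\frac{\mathrm{d}P}{\mathrm{d}Q}(o)-\alpha\Big)_+\Big]+P^{\perp}(\Omega)$$ be the hockey-stick divergence, where $\Omega$ is the underlying space, $(x)_+=\max\{x,0\}$, $\frac{\mathrm{d}P}{\mathrm{d}Q}$ is the density of the absolutely continuous part of $P$ with respect to $Q$, and $P^{\perp}$ is the part of $P$ singular to $Q$ (so the last term vanishes when $P\ll Q$). Then $\mathcal{M}$ has a tightly dominating pair of distributions under $\simeq$, and it can be taken to be univariate on $[0,1]$: there exist Borel probability distributions $P,Q$ on $[0,1]$ such that $$\sup_{D\simeq D'}H_\alpha\big(\mathcal{M}(D)\,\|\,\mathcal{M}(D')\big)=H_\alpha(P\|Q)\qquad\text{for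 all }\alpha\ge 0 .$$ -/

import Mathlib

open MeasureTheory
open scoped NNReal ENNReal

/-- The hockey-stick divergence `H_α(P‖Q) = E_{o ∼ Q} [(dP/dQ (o) - α)_+]` of two probability
distributions on the same measurable space, for `α ≥ 0`.

No absolute continuity is required: as usual for such divergences, `dP/dQ` is the density of the
absolutely continuous part of `P`, and the part of `P` that is singular to `Q` (where `dP/dQ` is
infinite) contributes its whole mass. The values lie in `[0, ∞]`, and the subtraction there is
truncated at `0`, so that it is the positive part. -/
noncomputable def hockeyStick {Ω : Type*} [MeasurableSpace Ω] (α : ℝ≥0)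
    (P Q : ProbabilityMeasure Ω) : ℝ≥0∞ :=
  (∫⁻ o, ((P : Measure Ω).rnDeriv (Q : Measure Ω) o - (α : ℝ≥0∞)) ∂(Q : Measure Ω))
    + (P : Measure Ω).singularPart (Q : Measure Ω) Set.univ

/-- The privacy profile of a mechanism `M` (a map from datasets to probability distributions on
the output space) under the neighbouring relation `nbr`:
`α ↦ sup_{D ≃ D'} H_α(M(D)‖M(D'))`. -/
noncomputable def privacyProfile {𝓓 𝓞 : Type*} [MeasurableSpace 𝓞]
    (M : 𝓓 → ProbabilityMeasure 𝓞) (nbr : 𝓓 → 𝓓 → Prop) (α : ℝ≥0) : ℝ≥0∞ :=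
  ⨆ (D : 𝓓) (D' : 𝓓) (_ : nbr D D'), hockeyStick α (M D) (M D')

/-- `(P, Q)` is a tightly dominating pair of distributions for `M` under `nbr`:
`sup_{D ≃ D'} H_α(M(D)‖M(D')) = H_α(P‖Q)` for all `α ≥ 0`. -/
def IsTightlyDominatingPair {𝓓 𝓞 Ω : Type*} [MeasurableSpace 𝓞] [MeasurableSpace Ω]
    (M : 𝓓 → ProbabilityMeasure 𝓞) (nbr : 𝓓 → 𝓓 → Prop) (P Q : ProbabilityMeasure Ω) : Prop :=
  ∀ α : ℝ≥0, privacyProfile M nbr α = hockeyStick α P Q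

open Set Filter Topology

/-! ### Properties of the hockey-stick divergence -/

section HockeyStick

variable {Ω : Type*} [MeasurableSpace Ω] (P Q : ProbabilityMeasure Ω)

/-! Every curve `α ↦ H_α(P‖Q)` is convex, nonincreasing, 1-Lipschitz and equal to 1 at 0, and these
properties survive a supremum over a nonempty family. Conversely, any such nonnegative `f` is
realized (`ConvexOn.exists_hockeyStick_eq`). Put `g = -f'` (right derivative), with values in `[0,
1]`, and `p = lim f` at infinity, so that `f a = ∫_a^∞ g + p`. Take `Q` uniform on `[0, 1]` and let
`P` have density `L u = |{t > 0 : g t > u}|`, the generalized inverse of `g`, plus an atom of mass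
`p`. The layer-cake formula gives `∫ (L - a)₊ = ∫_a^∞ g`, and the atom supplies `p`. -/

theorem hockeyStick_zero : hockeyStick 0 P Q = 1 := by
  have h := congrArg (fun μ : Measure Ω => μ univ)
    (Measure.rnDeriv_add_singularPart (P : Measure Ω) (Q : Measure Ω))
  simpa [hockeyStick] using h

theorem hockeyStick_antitone : Antitone fun α : ℝ≥0 => hockeyStick α P Q := by
  intro α β h
  exact add_le_add_left (lintegral_mono fun o => tsub_le_tsub_left (ENNReal.coe_le_coe.2 h) _) _

theorem hockeyStick_le_one (α : ℝ≥0) : hockeyStick α P Q ≤ 1 :=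
  (hockeyStick_antitone P Q (zero_le : 0 ≤ α)).trans_eq (hockeyStick_zero P Q)

/-- Holds because `Q` has mass 1. This Lipschitz bound later forces `g ≤ 1`, which lets the levels
of `g` range over the unit interval. -/
theorem hockeyStick_le_add (α β : ℝ≥0) :
    hockeyStick α P Q ≤ hockeyStick β P Q + (β - α : ℝ≥0) := by
  have key : ∫⁻ o, ((P : Measure Ω).rnDeriv (Q : Measure Ω) o - (α : ℝ≥0∞)) ∂(Q : Measure Ω) ≤
      ∫⁻ o, ((P : Measure Ω).rnDeriv (Q : Measure Ω) o - (β : ℝ≥0∞)) ∂(Q : Measure Ω) +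
        (β - α : ℝ≥0) := by
    calc
      _ ≤ ∫⁻ o, (((P : Measure Ω).rnDeriv (Q : Measure Ω) o - (β : ℝ≥0∞)) + (β - α : ℝ≥0))
            ∂(Q : Measure Ω) := by
        refine lintegral_mono fun o => ?_
        rw [ENNReal.coe_sub]
        exact tsub_le_tsub_add_tsub
      _ = _ := by
        rw [lintegral_add_right _ measurable_const]
        simp
  unfold hockeyStick
  calc _ ≤ _ := add_le_add_left key _
    _ = _ := by ring

/-- Pointwise, `α ↦ (x - α)₊` is convex; the singular mass does not depend on `α`. -/
theorem hockeyStick_convex (a b α β : ℝ≥0) (hab : a + b = 1) :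
    hockeyStick (a * α + b * β) P Q ≤ a * hockeyStick α P Q + b * hockeyStick β P Q := by
  have hab' : (a : ℝ≥0∞) + b = 1 := by exact_mod_cast hab
  have hm := (P : Measure Ω).measurable_rnDeriv (Q : Measure Ω)
  have key : ∫⁻ o, ((P : Measure Ω).rnDeriv (Q : Measure Ω) o - ((a * α + b * β : ℝ≥0) : ℝ≥0∞))
        ∂(Q : Measure Ω) ≤
      a * ∫⁻ o, ((P : Measure Ω).rnDeriv (Q : Measure Ω) o - (α : ℝ≥0∞)) ∂(Q : Measure Ω) +
      b * ∫⁻ o, ((P : Measure Ω).rnDeriv (Q : Measure Ω) o - (β : ℝ≥0∞)) ∂(Q : Measure Ω) := by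
    rw [← lintegral_const_mul _ (hm.sub_const _), ← lintegral_const_mul _ (hm.sub_const _),
      ← lintegral_add_left ((hm.sub_const _).const_mul _)]
    refine lintegral_mono fun o => ?_
    set x := (P : Measure Ω).rnDeriv (Q : Measure Ω) o
    refine tsub_le_iff_right.2 ?_
    push_cast
    calc x = a * x + b * x := by rw [← add_mul, hab', one_mul]
      _ ≤ a * ((x - α) + α) + b * ((x - β) + β) := by
        gcongr <;> exact le_tsub_add
      _ = _ := by ring
  unfold hockeyStick
  calc
    _ ≤ _ := add_le_add_left key _
    _ = a * ∫⁻ o, ((P : Measure Ω).rnDeriv (Q : Measure Ω) o - (α : ℝ≥0∞)) ∂(Q : Measure Ω) +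
        b * ∫⁻ o, ((P : Measure Ω).rnDeriv (Q : Measure Ω) o - (β : ℝ≥0∞)) ∂(Q : Measure Ω) +
        (a + b) * (P : Measure Ω).singularPart (Q : Measure Ω) univ := by rw [hab', one_mul]
    _ = _ := by ring

end HockeyStick

/-! ### Properties of privacy profiles -/

section Profile

variable {𝓓 𝓞 : Type*} [MeasurableSpace 𝓞] (M : 𝓓 → ProbabilityMeasure 𝓞) (nbr : 𝓓 → 𝓓 → Prop)

theorem hockeyStick_le_privacyProfile {D D' : 𝓓} (h : nbr D D') (α : ℝ≥0) :
    hockeyStick α (M D) (M D') ≤ privacyProfile M nbr α :=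
  le_iSup₂_of_le D D' (le_iSup_of_le h le_rfl)

theorem privacyProfile_le {α : ℝ≥0} {c : ℝ≥0∞}
    (h : ∀ D D', nbr D D' → hockeyStick α (M D) (M D') ≤ c) : privacyProfile M nbr α ≤ c :=
  iSup₂_le fun D D' => iSup_le fun hD => h D D' hD

theorem privacyProfile_antitone : Antitone (privacyProfile M nbr) := fun _ _ h =>
  privacyProfile_le M nbr fun _ _ hD =>
    (hockeyStick_antitone _ _ h).trans (hockeyStick_le_privacyProfile M nbr hD _)

theorem privacyProfile_le_one (α : ℝ≥0) : privacyProfile M nbr α ≤ 1 :=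
  privacyProfile_le M nbr fun _ _ _ => hockeyStick_le_one _ _ _

theorem privacyProfile_zero (hnbr : ∃ D D' : 𝓓, nbr D D') : privacyProfile M nbr 0 = 1 := by
  obtain ⟨D, D', h⟩ := hnbr
  refine le_antisymm (privacyProfile_le_one M nbr 0) ?_
  rw [← hockeyStick_zero (M D) (M D')]
  exact hockeyStick_le_privacyProfile M nbr h 0

theorem privacyProfile_le_add (α β : ℝ≥0) :
    privacyProfile M nbr α ≤ privacyProfile M nbr β + (β - α : ℝ≥0) :=
  privacyProfile_le M nbr fun _ _ hD => (hockeyStick_le_add _ _ α β).trans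
    (add_le_add_left (hockeyStick_le_privacyProfile M nbr hD _) _)

theorem privacyProfile_convex (a b α β : ℝ≥0) (hab : a + b = 1) :
    privacyProfile M nbr (a * α + b * β) ≤
      a * privacyProfile M nbr α + b * privacyProfile M nbr β :=
  privacyProfile_le M nbr fun _ _ hD => (hockeyStick_convex _ _ a b α β hab).trans <| by
    gcongr <;> exact hockeyStick_le_privacyProfile M nbr hD _

end Profile

/-! ### A convex function as the integral of its right derivative -/

/-- A nonnegative, nonincreasing, `1`-Lipschitz convex function on `[0, ∞)` is, up to a constant,
the tail integral of a nonincreasing function with values in `[0, 1]`. -/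
theorem ConvexOn.exists_antitoneOn_lintegral_Ioi {f : ℝ → ℝ} (hconv : ConvexOn ℝ (Ici 0) f)
    (hanti : AntitoneOn f (Ici 0)) (hnn : ∀ x, 0 ≤ x → 0 ≤ f x)
    (hlip : ∀ x y, 0 ≤ x → x ≤ y → f x ≤ f y + (y - x)) :
    ∃ (g : ℝ → ℝ) (p : ℝ), Measurable g ∧ AntitoneOn g (Ioi 0) ∧ (∀ t, 0 < t → 0 ≤ g t) ∧
      (∀ t, 0 < t → g t ≤ 1) ∧
      ∀ a, 0 ≤ a → (∫⁻ t in Ioi a, ENNReal.ofReal (g t)) + ENNReal.ofReal p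
        = ENNReal.ofReal (f a) := by
  set g : ℝ → ℝ := fun t => -derivWithin f (Ioi t) t with hg
  have hmeas : Measurable g := (measurable_derivWithin_Ioi f).neg
  have hder : ∀ t, 0 < t → HasDerivWithinAt f (-g t) (Ioi t) t := fun t ht => by
    simpa [hg] using hconv.hasDerivWithinAt_rightDeriv_of_mem_interior (x := t) (by simpa using ht)
  have hganti : AntitoneOn g (Ioi 0) := by
    have := hconv.monotoneOn_rightDeriv
    rw [interior_Ici] at this
    exact this.neg
  have hslope : ∀ t, 0 < t →
      Tendsto (fun y => (y - t)⁻¹ * (f y - f t)) (𝓝[>] t) (𝓝 (-g t)) := fun t ht => by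
    have h := (hasDerivWithinAt_iff_tendsto_slope' (by simp)).1 (hder t ht)
    exact h
  have hg0 : ∀ t, 0 < t → 0 ≤ g t := fun t ht => by
    have : -g t ≤ 0 := by
      refine le_of_tendsto (hslope t ht) ?_
      filter_upwards [self_mem_nhdsWithin] with y (hy : t < y)
      refine mul_nonpos_of_nonneg_of_nonpos (inv_nonneg.2 (sub_nonneg.2 hy.le)) ?_
      exact sub_nonpos.2 (hanti ht.le (ht.trans hy).le hy.le)
    linarith
  have hg1 : ∀ t, 0 < t → g t ≤ 1 := fun t ht => by
    have : -1 ≤ -g t := by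
      refine ge_of_tendsto (hslope t ht) ?_
      filter_upwards [self_mem_nhdsWithin] with y (hy : t < y)
      have hy' : 0 < y - t := sub_pos.2 hy
      rw [inv_mul_eq_div, le_div_iff₀ hy']
      linarith [hlip t y ht.le hy.le]
    linarith
  have hcont : ContinuousOn f (Ici 0) := by
    have : LipschitzOnWith 1 f (Ici 0) := by
      refine LipschitzOnWith.of_le_add fun x hx y hy => ?_
      rcases le_total x y with h | h
      · rw [Real.dist_eq, abs_of_nonpos (by linarith)]
        linarith [hlip x y hx h]
      · exact (hanti hy hx h).trans (le_add_of_nonneg_right dist_nonneg)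
    exact this.continuousOn
  have hint : ∀ a b, 0 ≤ a → IntegrableOn g (Ioc a b) := fun a b ha => by
    refine Measure.integrableOn_of_bounded (M := 1) (by simp)
      hmeas.aestronglyMeasurable ?_
    refine (ae_restrict_iff' measurableSet_Ioc).2 (ae_of_all _ fun t ht => ?_)
    have ht' : 0 < t := ha.trans_lt ht.1
    rw [Real.norm_of_nonneg (hg0 t ht')]
    exact hg1 t ht'
  have hftc : ∀ a b, 0 ≤ a → a ≤ b → ∫ t in a..b, g t = f a - f b := fun a b ha hab => by
    have h := intervalIntegral.integral_eq_sub_of_hasDeriv_right (f := f) (f' := fun t => -g t)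
      (a := a) (b := b)
      (hcont.mono (by rw [uIcc_of_le hab]; exact fun x hx => ha.trans hx.1))
      (fun x hx => hder x (by rw [min_eq_left hab] at hx; exact ha.trans_lt hx.1))
      ((intervalIntegrable_iff_integrableOn_Ioc_of_le hab).2 (hint a b ha).neg)
    rw [intervalIntegral.integral_neg] at h
    linarith
  -- `p` is the limit of `f` at infinity, the future singular mass.
  obtain ⟨p, hp0, hp⟩ : ∃ p : ℝ, 0 ≤ p ∧ Tendsto (fun n : ℕ => f n) atTop (𝓝 p) := by
    have hbdd : BddBelow (range fun n : ℕ => f n) :=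
      ⟨0, by rintro _ ⟨n, rfl⟩; exact hnn n (Nat.cast_nonneg n)⟩
    refine ⟨⨅ n : ℕ, f n, le_ciInf fun n => hnn n (Nat.cast_nonneg n), tendsto_atTop_ciInf ?_ hbdd⟩
    intro m n hmn
    exact hanti (mem_Ici.2 (Nat.cast_nonneg m)) (mem_Ici.2 (Nat.cast_nonneg n)) (Nat.cast_le.2 hmn)
  refine ⟨g, p, hmeas, hganti, hg0, hg1, fun a ha => ?_⟩
  have hgInt : IntegrableOn g (Ioi a) := by
    refine integrableOn_Ioi_of_intervalIntegral_norm_bounded (l := atTop)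
      (b := fun n : ℕ => (n : ℝ)) (f a) a (fun n => hint a n ha) tendsto_natCast_atTop_atTop ?_
    filter_upwards [tendsto_natCast_atTop_atTop.eventually (eventually_ge_atTop a)] with n hn
    have : ∫ t in a..(n : ℝ), ‖g t‖ = ∫ t in a..(n : ℝ), g t := by
      refine intervalIntegral.integral_congr_ae (ae_of_all _ fun t ht => ?_)
      rw [uIoc_of_le hn] at ht
      exact Real.norm_of_nonneg (hg0 t (ha.trans_lt ht.1))
    rw [this, hftc a n ha hn]
    linarith [hnn n (Nat.cast_nonneg n)]
  have hae : 0 ≤ᵐ[volume.restrict (Ioi a)] g :=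
    (ae_restrict_iff' measurableSet_Ioi).2 (ae_of_all _ fun t ht => hg0 t (ha.trans_lt ht))
  have hlim : ∫ t in Ioi a, g t = f a - p := by
    refine tendsto_nhds_unique
      (intervalIntegral_tendsto_integral_Ioi a hgInt tendsto_natCast_atTop_atTop) ?_
    refine (tendsto_const_nhds.sub hp).congr' ?_
    filter_upwards [tendsto_natCast_atTop_atTop.eventually (eventually_ge_atTop a)] with n hn
    exact (hftc a n ha hn).symm
  rw [← ofReal_integral_eq_lintegral_ofReal hgInt hae, ← ENNReal.ofReal_add
    (integral_nonneg_of_ae hae) hp0, hlim, sub_add_cancel]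

/-! ### Realization by a pair of distributions on the unit interval -/

/-- For the generalized inverse of a nonincreasing function, subtracting `a` amounts to discarding
the arguments below `a`. -/
theorem AntitoneOn.volume_Ioi_inter_lt_sub {g : ℝ → ℝ} (hg : AntitoneOn g (Ioi 0)) (u : ℝ)
    {a : ℝ} (ha : 0 ≤ a) :
    volume (Ioi 0 ∩ {t | u < g t}) - ENNReal.ofReal a = volume (Ioi a ∩ {t | u < g t}) := by
  have hsplit : Ioi 0 ∩ {t | u < g t} = (Ioc 0 a ∩ {t | u < g t}) ∪ (Ioi a ∩ {t | u < g t}) := by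
    rw [← union_inter_distrib_right, Ioc_union_Ioi_eq_Ioi ha]
  have hvol : volume (Ioc 0 a) = ENNReal.ofReal a := by simp
  -- The superlevel set is an initial segment of `(0, ∞)`: either it stops by `a` and both sides
  -- vanish, or it contains all of `(0, a]`.
  rcases (Ioi a ∩ {t | u < g t}).eq_empty_or_nonempty with he | ⟨s, hs, hsg⟩
  · rw [hsplit, he, union_empty, measure_empty, tsub_eq_zero_iff_le, ← hvol]
    exact measure_mono inter_subset_left
  · have hsub : Ioc 0 a ∩ {t | u < g t} = Ioc 0 a := inter_eq_left.2 fun t ht =>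
      lt_of_lt_of_le hsg (hg ht.1 (ha.trans_lt hs) (ht.2.trans (le_of_lt hs)))
    rw [hsplit, hsub, measure_union' _ measurableSet_Ioc, hvol,
      ENNReal.add_sub_cancel_left ENNReal.ofReal_ne_top]
    exact disjoint_left.2 fun t ht ht' => not_lt.2 ht.2 ht'.1

/-- Layer-cake formula; levels above 1 contribute nothing since `g ≤ 1`. -/
theorem lintegral_unitInterval_volume_Ioi_inter_lt {g : ℝ → ℝ} (hmeas : Measurable g) {a : ℝ}
    (hg0 : ∀ t, a < t → 0 ≤ g t) (hg1 : ∀ t, a < t → g t ≤ 1) :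
    ∫⁻ u : unitInterval, volume (Ioi a ∩ {t | (u : ℝ) < g t}) =
      ∫⁻ t in Ioi a, ENNReal.ofReal (g t) := by
  have hae : 0 ≤ᵐ[volume.restrict (Ioi a)] g :=
    (ae_restrict_iff' measurableSet_Ioi).2 (ae_of_all _ fun t ht => hg0 t ht)
  rw [lintegral_eq_lintegral_meas_lt _ hae hmeas.aemeasurable]
  have hset : ∀ u : ℝ, (volume.restrict (Ioi a)) {t | u < g t} = volume (Ioi a ∩ {t | u < g t}) :=
    fun u => by
      rw [Measure.restrict_apply (measurableSet_lt measurable_const hmeas), inter_comm]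
  simp_rw [hset]
  rw [unitInterval.volume_def, lintegral_subtype_comap (s := unitInterval) measurableSet_Icc
    (fun u : ℝ => volume (Ioi a ∩ {t | u < g t})),
    ← restrict_Ioc_eq_restrict_Icc, ← Ioc_union_Ioi_eq_Ioi (zero_le_one (α := ℝ)),
    lintegral_union measurableSet_Ioi (Ioc_disjoint_Ioi le_rfl)]
  have hzero : ∫⁻ u in Ioi (1 : ℝ), volume (Ioi a ∩ {t | u < g t}) = 0 := by
    rw [← lintegral_zero (μ := volume.restrict (Ioi (1 : ℝ)))]
    refine setLIntegral_congr_fun measurableSet_Ioi fun u hu => ?_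
    have : Ioi a ∩ {t | u < g t} = ∅ := eq_empty_iff_forall_notMem.2 fun t ht =>
      absurd (hg1 t ht.1) (not_le.2 (lt_trans hu ht.2))
    simp [this]
  rw [hzero, add_zero]

/-- Every nonnegative, nonincreasing, `1`-Lipschitz convex function on `[0, ∞)` with value `1` at
`0` is the hockey-stick divergence curve of a pair of distributions on the unit interval. -/
theorem ConvexOn.exists_hockeyStick_eq {f : ℝ → ℝ} (hconv : ConvexOn ℝ (Ici 0) f)
    (hanti : AntitoneOn f (Ici 0)) (hnn : ∀ x, 0 ≤ x → 0 ≤ f x)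
    (hlip : ∀ x y, 0 ≤ x → x ≤ y → f x ≤ f y + (y - x)) (hf0 : f 0 = 1) :
    ∃ P Q : ProbabilityMeasure unitInterval,
      ∀ α : ℝ≥0, hockeyStick α P Q = ENNReal.ofReal (f α) := by
  obtain ⟨g, p, hmeas, hganti, hg0, hg1, hint⟩ :=
    hconv.exists_antitoneOn_lintegral_Ioi hanti hnn hlip
  set L : unitInterval → ℝ≥0∞ := fun u => volume (Ioi 0 ∩ {t | (u : ℝ) < g t}) with hL
  have hLm : Measurable L := by
    refine Antitone.measurable fun u v huv => measure_mono ?_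
    exact inter_subset_inter_right _ fun t (ht : (v : ℝ) < g t) =>
      lt_of_le_of_lt (Subtype.coe_le_coe.2 huv) ht
  have hLsub : ∀ α : ℝ≥0, (∫⁻ u, (L u - α)) + ENNReal.ofReal p = ENNReal.ofReal (f α) := by
    intro α
    have : ∀ u, L u - α = volume (Ioi (α : ℝ) ∩ {t | (u : ℝ) < g t}) := fun u => by
      rw [← hganti.volume_Ioi_inter_lt_sub u α.coe_nonneg]
      simp [hL]
    simp_rw [this]
    rw [lintegral_unitInterval_volume_Ioi_inter_lt hmeas
      (fun t ht => hg0 t (α.coe_nonneg.trans_lt ht)) (fun t ht => hg1 t (α.coe_nonneg.trans_lt ht))]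
    exact hint α α.coe_nonneg
  -- The atom's location is immaterial: any point is Lebesgue-null.
  set s : Measure unitInterval := ENNReal.ofReal p • Measure.dirac 1 with hs
  set μ : Measure unitInterval := s + volume.withDensity L with hμ
  have hsing : s ⟂ₘ (volume : Measure unitInterval) :=
    ((mutuallySingular_dirac 1 volume).smul _)
  have hprob : IsProbabilityMeasure μ := by
    constructor
    -- At `α = 0` the identity says that the total mass is `f 0 = 1`.
    have h := hLsub 0
    simp only [ENNReal.coe_zero, tsub_zero, NNReal.coe_zero, hf0, ENNReal.ofReal_one] at h
    simpa [hμ, hs, add_comm] using h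
  refine ⟨⟨μ, hprob⟩, ⟨volume, inferInstance⟩, fun α => ?_⟩
  rw [← hLsub α]
  unfold hockeyStick
  simp only [ProbabilityMeasure.coe_mk]
  -- Uniqueness of the Lebesgue decomposition identifies `s` and `L` with the singular part and the
  -- density.
  rw [← Measure.eq_singularPart hLm hsing hμ]
  congr 1
  · refine lintegral_congr_ae ?_
    filter_upwards [Measure.eq_rnDeriv hLm hsing hμ] with u hu
    rw [hu]
  · simp [hs]

theorem mainTheorem4 {𝓓 𝓞 : Type*} [MeasurableSpace 𝓞]
    (M : 𝓓 → ProbabilityMeasure 𝓞) (nbr : 𝓓 → 𝓓 → Prop)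
    (hnbr : ∃ D D' : 𝓓, nbr D D') :
    ∃ P Q : ProbabilityMeasure (Set.Icc (0 : ℝ) 1), IsTightlyDominatingPair M nbr P Q := by
  have htop : ∀ α, privacyProfile M nbr α ≠ ∞ := fun α =>
    ((privacyProfile_le_one M nbr α).trans_lt ENNReal.one_lt_top).ne
  set f : ℝ → ℝ := fun x => (privacyProfile M nbr x.toNNReal).toReal with hf
  have hconv : ConvexOn ℝ (Ici 0) f := by
    refine ⟨convex_Ici 0, fun x hx y hy a b ha hb hab => ?_⟩
    lift x to ℝ≥0 using hx
    lift y to ℝ≥0 using hy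
    lift a to ℝ≥0 using ha
    lift b to ℝ≥0 using hb
    have h := ENNReal.toReal_mono
      (ENNReal.add_ne_top.2 ⟨ENNReal.mul_ne_top ENNReal.coe_ne_top (htop x),
        ENNReal.mul_ne_top ENNReal.coe_ne_top (htop y)⟩)
      (privacyProfile_convex M nbr a b x y (by exact_mod_cast hab))
    rw [ENNReal.toReal_add (ENNReal.mul_ne_top ENNReal.coe_ne_top (htop x))
      (ENNReal.mul_ne_top ENNReal.coe_ne_top (htop y)), ENNReal.toReal_mul,
      ENNReal.toReal_mul] at h
    have hcast : (a : ℝ) • (x : ℝ) + (b : ℝ) • (y : ℝ) = ((a * x + b * y : ℝ≥0) : ℝ) := by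
      simp
    simp only [hf, hcast, Real.toNNReal_coe]
    simpa using h
  have hanti : AntitoneOn f (Ici 0) := fun x _ y _ hxy =>
    ENNReal.toReal_mono (htop _) (privacyProfile_antitone M nbr (Real.toNNReal_mono hxy))
  have hlip : ∀ x y, 0 ≤ x → x ≤ y → f x ≤ f y + (y - x) := fun x y hx hxy => by
    have h := ENNReal.toReal_mono (ENNReal.add_ne_top.2 ⟨htop _, ENNReal.coe_ne_top⟩)
      (privacyProfile_le_add M nbr x.toNNReal y.toNNReal)
    rw [ENNReal.toReal_add (htop _) ENNReal.coe_ne_top, ENNReal.coe_toReal,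
      NNReal.coe_sub (Real.toNNReal_mono hxy), Real.coe_toNNReal _ hx,
      Real.coe_toNNReal _ (hx.trans hxy)] at h
    exact h
  obtain ⟨P, Q, hPQ⟩ := hconv.exists_hockeyStick_eq hanti
    (fun _ _ => ENNReal.toReal_nonneg) hlip (by simp [hf, privacyProfile_zero M nbr hnbr])
  refine ⟨P, Q, fun α => ?_⟩
  rw [hPQ α]
  simp [hf, ENNReal.ofReal_toReal (htop α)]
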